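/- Let $\rho_{AB}$ be a real two-qubit state, that is, a positive semidefinite operator of trace one on $\mathbb{C}^2\otimes\mathbb{C}^2$ whose matrix entries in the standard basis are real. For $\theta\in\mathbb{R}$ put $|\theta\rangle=\cos\frac{\theta}{2}|0\rangle+\sin\frac{\theta}{2}|1\rangle$, and let the steering ellipse of $\rho_{AB}$ be the $2\pi$-periodic curve of real Hermitian $2\times 2$ operators $$\tilde\rho_B(\theta)=\mathrm{Tr}_A\left[(|\theta\rangle\langle\theta|\otimes\mathbb{I}_B)\,\rho_{AB}\right].$$ Assume the following. (i) The steering ellipse has tilt $<1$. Here the tilt of a real Hermitian operator $\frac12(n\mathbb{I}+r_1\sigma_1+r_3\sigma_3)$, with $\sigma_1=|0\rangle\langle 1|+|1\rangle\langle 0|$ and $\sigma_3=|0\rangle\langle 0|-|1\rangle\langle 1|$, is $\sqrt{r_1^2+r_3^2}/|n|$ (and $\infty$ if $n=0$). The tilt of the steering ellipse is the tilt of any nonzero real Hermitian operator that is normal, for the inner product $\langle X,Y\rangle=\mathrm{Tr}(X^\dagger Y)$, to the affine space spanned by the ellipse if this space is two-dimensional, and is $\infty$ otherwise. (ii) The steering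 ellipse has a local hidden state model: there are a Borel probability measure $\mu$ on the set $\mathbb{RP}^1$ of one-dimensional real orthogonal projectors on $\mathbb{C}^2$ and measurable functions $f_\theta\colon\mathbb{RP}^1\to[0,1]$, $\theta\in\mathbb{R}$, such that $\tilde\rho_B(\theta)=\int_{\mathbb{RP}^1}x\,f_\theta(x)\,\mathrm{d}\mu(x)$ for all $\theta$. Then the length of the steering ellipse in the trace norm $\|X\|_1=\mathrm{Tr}\sqrt{X^\dagger X}$ is at most $2$: the curve $\tilde\rho_B$ is differentiable, $\theta\mapsto\left\|\frac{\mathrm{d}}{\mathrm{d}\theta}\tilde\rho_B(\theta)\right\|_1$ is integrable on $[0,2\pi]$, and $$\int_0^{2\pi}\left\|\frac{\mathrm{d}}{\mathrm{d}\theta}\tilde\rho_B(\theta)\right\|_1\mathrm{d}\theta\le 2.$$ -/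

import Mathlib

open MeasureTheory Matrix
open scoped ComplexOrder MatrixOrder Kronecker ENNReal

noncomputable section

/-- Operators on one qubit `ℂ²`, as matrices in the standard basis. -/
abbrev QubitOp : Type := Matrix (Fin 2) (Fin 2) ℂ

/-- Operators on two qubits `ℂ² ⊗ ℂ²`; the first index is Alice's, the second is Bob's. -/
abbrev TwoQubitOp : Type := Matrix (Fin 2 × Fin 2) (Fin 2 × Fin 2) ℂ

/-- An operator is real if all its entries in the standard basis are real numbers. -/
def IsRealOp {ι : Type*} (X : Matrix ι ι ℂ) : Prop :=
  ∀ i j, (X i j).im = 0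

/-- Real density operators: positive semidefinite, of trace one, with real entries. -/
def IsRealDensity {ι : Type*} [Fintype ι] (ρ : Matrix ι ι ℂ) : Prop :=
  ρ.PosSemidef ∧ ρ.trace = 1 ∧ IsRealOp ρ

/-- The set of one-dimensional real orthogonal projectors on `ℂ²`. -/
def RP1 : Set QubitOp :=
  {P | P.IsHermitian ∧ P * P = P ∧ P.trace = 1 ∧ IsRealOp P}

/-- `RP1` carries the Borel σ-algebra of the topology inherited from the space of matrices. -/
instance instMeasurableSpaceRP1 : MeasurableSpace RP1 := borel RP1

instance instBorelSpaceRP1 : BorelSpace RP1 := ⟨rfl⟩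

/-- The absolute value is `|X| = √(X† X)`, and the trace norm is `‖X‖₁ = Tr |X|`. -/
def traceNorm (X : QubitOp) : ℝ :=
  (CFC.abs X).trace.re

/-- The Pauli operator `σ₁ = |0⟩⟨1| + |1⟩⟨0|`. -/
def pauli1 : QubitOp := !![0, 1; 1, 0]

/-- The Pauli operator `σ₃ = |0⟩⟨0| - |1⟩⟨1|`. -/
def pauli3 : QubitOp := !![1, 0; 0, -1]

/-- The coordinate `n` of a real Hermitian operator `(n I + r₁ σ₁ + r₃ σ₃) / 2`. -/
def blochN (X : QubitOp) : ℝ := X.trace.re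

/-- The coordinate `r₁` of a real Hermitian operator `(n I + r₁ σ₁ + r₃ σ₃) / 2`. -/
def blochR1 (X : QubitOp) : ℝ := (X * pauli1).trace.re

/-- The coordinate `r₃` of a real Hermitian operator `(n I + r₁ σ₁ + r₃ σ₃) / 2`. -/
def blochR3 (X : QubitOp) : ℝ := (X * pauli3).trace.re

/-- Every real Hermitian operator on `ℂ²` is recovered from its three coordinates. -/
theorem eq_bloch {X : QubitOp} (hX : X.IsHermitian) (hr : IsRealOp X) :
    X = (1 / 2 : ℂ) • ((blochN X : ℂ) • (1 : QubitOp) + (blochR1 X : ℂ) • pauli1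
      + (blochR3 X : ℂ) • pauli3) := by
  have h01 := hX.apply 0 1
  have hre : (X 1 0).re = (X 0 1).re := by
    have := congrArg Complex.re h01
    simpa using this
  ext i j
  have := hr i j
  fin_cases i <;> fin_cases j <;>
    simp_all [blochN, blochR1, blochR3, pauli1, pauli3, Matrix.trace, Fin.sum_univ_two,
      Matrix.mul_apply, Complex.ext_iff] <;> ring

open Classical in
/-- The tilt `√(r₁² + r₃²) / |n|` of a real Hermitian operator, which is `∞` when `n = 0`. -/
def tilt (X : QubitOp) : ℝ≥0∞ :=
  if blochN X = 0 then ⊤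
  else ENNReal.ofReal (Real.sqrt (blochR1 X ^ 2 + blochR3 X ^ 2) / |blochN X|)

/-- The unit vector `|θ⟩ = cos (θ/2) |0⟩ + sin (θ/2) |1⟩`. -/
def ketTheta (θ : ℝ) : Fin 2 → ℂ :=
  ![(Real.cos (θ / 2) : ℂ), (Real.sin (θ / 2) : ℂ)]

/-- The projector `|θ⟩⟨θ|`. -/
def projTheta (θ : ℝ) : QubitOp :=
  Matrix.vecMulVec (ketTheta θ) (star (ketTheta θ))

/-- The partial trace over Alice's qubit. -/
def partialTraceA (M : TwoQubitOp) : QubitOp :=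
  Matrix.of fun i j => ∑ k : Fin 2, M (k, i) (k, j)

/-- The steering ellipse `ρ̃_B(θ) = Tr_A [(|θ⟩⟨θ| ⊗ I) ρ_AB]`. -/
def steeringEllipse (ρ : TwoQubitOp) (θ : ℝ) : QubitOp :=
  partialTraceA ((projTheta θ ⊗ₖ (1 : QubitOp)) * ρ)

/-- `H` is a nonzero real Hermitian operator that is normal, for the inner product
`⟨X, Y⟩ = Tr (X† Y)`, to the affine space spanned by the steering ellipse. -/
def IsNormalToEllipse (ρ : TwoQubitOp) (H : QubitOp) : Prop :=
  H ≠ 0 ∧ H.IsHermitian ∧ IsRealOp H ∧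
    ∀ v ∈ vectorSpan ℝ (Set.range (steeringEllipse ρ)), (Hᴴ * v).trace = 0

open Classical in
/-- The tilt of the steering ellipse. If the ellipse spans a two-dimensional affine space, then
its normal vectors in the three-dimensional space of real Hermitian operators are the nonzero
multiples of one of them, so they all have the same tilt and the infimum is this common value
(see `tilt_eq_ellipseTilt`). If the ellipse is degenerate, the tilt is `∞`. -/
def ellipseTilt (ρ : TwoQubitOp) : ℝ≥0∞ :=
  if Module.finrank ℝ (vectorSpan ℝ (Set.range (steeringEllipse ρ))) = 2 then
    ⨅ (H : QubitOp) (_ : IsNormalToEllipse ρ H), tilt H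
  else ⊤

theorem steeringEllipse_apply (ρ : TwoQubitOp) (θ : ℝ) (i j : Fin 2) :
    steeringEllipse ρ θ i j = ∑ k : Fin 2, ∑ l : Fin 2, projTheta θ k l * ρ (l, i) (k, j) := by
  simp only [steeringEllipse, partialTraceA, Matrix.of_apply]
  refine Finset.sum_congr rfl fun k _ => ?_
  rw [Matrix.mul_apply, Fintype.sum_prod_type]
  refine Finset.sum_congr rfl fun l _ => ?_
  simp [Matrix.kroneckerMap_apply, Matrix.one_apply]

theorem steeringEllipse_isRealOp {ρ : TwoQubitOp} (hr : IsRealOp ρ) (θ : ℝ) :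
    IsRealOp (steeringEllipse ρ θ) := by
  intro i j
  have h1 : ∀ k l, (projTheta θ k l).im = 0 := by
    intro k l
    rw [projTheta, Matrix.vecMulVec_apply, Pi.star_apply]
    fin_cases k <;> fin_cases l <;> simp [ketTheta, -Complex.ofReal_cos, -Complex.ofReal_sin]
  rw [steeringEllipse_apply]
  simp [Fin.sum_univ_two, h1, hr _ _]

theorem steeringEllipse_isHermitian {ρ : TwoQubitOp} (hh : ρ.IsHermitian) (θ : ℝ) :
    (steeringEllipse ρ θ).IsHermitian := by
  ext i j
  have h1 : ∀ k l, star (projTheta θ k l) = projTheta θ l k := by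
    intro k l
    simp [projTheta, Matrix.vecMulVec_apply, mul_comm]
  rw [Matrix.conjTranspose_apply, steeringEllipse_apply, steeringEllipse_apply, star_sum,
    Finset.sum_comm]
  simp only [star_sum, star_mul', h1, hh.apply]

/-- The coordinates `(n, r₁, r₃)` as a vector of three-dimensional Euclidean space. -/
def blochVec : QubitOp →ₗ[ℝ] EuclideanSpace ℝ (Fin 3) where
  toFun X := !₂[blochN X, blochR1 X, blochR3 X]
  map_add' X Y := by
    ext i; fin_cases i <;> simp [blochN, blochR1, blochR3, add_mul]
  map_smul' c X := by
    ext i; fin_cases i <;> simp [blochN, blochR1, blochR3]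

theorem trace_mul_eq_inner_blochVec {X Y : QubitOp} (hX : X.IsHermitian) (hXr : IsRealOp X)
    (hY : Y.IsHermitian) (hYr : IsRealOp Y) :
    (Xᴴ * Y).trace = ((inner ℝ (blochVec X) (blochVec Y) / 2 : ℝ) : ℂ) := by
  have h : inner ℝ (blochVec X) (blochVec Y) = blochN X * blochN Y + blochR1 X * blochR1 Y
      + blochR3 X * blochR3 Y := by
    simp [blochVec, PiLp.inner_apply, Fin.sum_univ_three]
    ring
  rw [h, hX.eq]
  conv_lhs => rw [eq_bloch hX hXr, eq_bloch hY hYr]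
  generalize blochN X = a
  generalize blochR1 X = b
  generalize blochR3 X = c
  generalize blochN Y = a'
  generalize blochR1 Y = b'
  generalize blochR3 Y = c'
  simp [pauli1, pauli3, Matrix.trace, Fin.sum_univ_two, Matrix.mul_apply, Matrix.one_apply]
  ring

theorem eq_of_blochVec_eq {X Y : QubitOp} (hX : X.IsHermitian) (hXr : IsRealOp X)
    (hY : Y.IsHermitian) (hYr : IsRealOp Y) (h : blochVec X = blochVec Y) : X = Y := by
  have h0 : blochN X = blochN Y := by simpa [blochVec] using congrArg (fun v => v 0) h
  have h1 : blochR1 X = blochR1 Y := by simpa [blochVec] using congrArg (fun v => v 1) h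
  have h3 : blochR3 X = blochR3 Y := by simpa [blochVec] using congrArg (fun v => v 2) h
  rw [eq_bloch hX hXr, eq_bloch hY hYr, h0, h1, h3]

theorem isHermitian_isRealOp_of_mem_vectorSpan {ρ : TwoQubitOp} (hh : ρ.IsHermitian)
    (hr : IsRealOp ρ) {v : QubitOp}
    (hv : v ∈ vectorSpan ℝ (Set.range (steeringEllipse ρ))) : v.IsHermitian ∧ IsRealOp v := by
  rw [vectorSpan_def] at hv
  induction hv using Submodule.span_induction with
  | mem x hx =>
    obtain ⟨_, ⟨s, rfl⟩, _, ⟨t, rfl⟩, rfl⟩ := hx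
    refine ⟨(steeringEllipse_isHermitian hh s).sub (steeringEllipse_isHermitian hh t), ?_⟩
    intro i j
    simp [steeringEllipse_isRealOp hr s i j, steeringEllipse_isRealOp hr t i j]
  | zero => exact ⟨Matrix.isHermitian_zero, fun i j => by simp⟩
  | add x y _ _ hx hy =>
    exact ⟨hx.1.add hy.1, fun i j => by simp [hx.2 i j, hy.2 i j]⟩
  | smul a x _ hx =>
    refine ⟨?_, fun i j => by simp [hx.2 i j]⟩
    ext i j
    have := hx.1.apply i j
    simp only [Matrix.conjTranspose_apply, Matrix.smul_apply, star_smul, this]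
    simp

theorem tilt_smul {X : QubitOp} {c : ℝ} (hc : c ≠ 0) : tilt (c • X) = tilt X := by
  have h0 : blochN (c • X) = c * blochN X := by simp [blochN]
  have h1 : blochR1 (c • X) = c * blochR1 X := by simp [blochR1]
  have h3 : blochR3 (c • X) = c * blochR3 X := by simp [blochR3]
  unfold tilt
  rw [h0, h1, h3]
  by_cases h : blochN X = 0
  · simp [h]
  · rw [if_neg (mul_ne_zero hc h), if_neg h]
    congr 1
    rw [show (c * blochR1 X) ^ 2 + (c * blochR3 X) ^ 2
      = c ^ 2 * (blochR1 X ^ 2 + blochR3 X ^ 2) by ring, Real.sqrt_mul (sq_nonneg c),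
      Real.sqrt_sq_eq_abs, abs_mul]
    exact mul_div_mul_left _ _ (abs_ne_zero.mpr hc)

theorem exists_smul_eq_of_isNormalToEllipse {ρ : TwoQubitOp} (hρ : IsRealDensity ρ)
    (hdim : Module.finrank ℝ (vectorSpan ℝ (Set.range (steeringEllipse ρ))) = 2)
    {H K : QubitOp} (hH : IsNormalToEllipse ρ H) (hK : IsNormalToEllipse ρ K) :
    ∃ c : ℝ, c ≠ 0 ∧ c • H = K := by
  obtain ⟨hρ1, -, hρ3⟩ := hρ
  set V := vectorSpan ℝ (Set.range (steeringEllipse ρ)) with hV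
  have hmem : ∀ v ∈ V, v.IsHermitian ∧ IsRealOp v := fun v hv =>
    isHermitian_isRealOp_of_mem_vectorSpan hρ1.1 hρ3 hv
  have hinj : Function.Injective (blochVec.domRestrict V) := by
    intro x y hxy
    exact Subtype.ext (eq_of_blochVec_eq (hmem _ x.2).1 (hmem _ x.2).2 (hmem _ y.2).1
      (hmem _ y.2).2 hxy)
  have hW : Module.finrank ℝ (V.map blochVec) = 2 := by
    have h := LinearMap.finrank_range_of_inj hinj
    rwa [LinearMap.range_domRestrict, hdim] at h
  have hWo : Module.finrank ℝ (V.map blochVec)ᗮ = 1 := by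
    have := Submodule.finrank_add_finrank_orthogonal (V.map blochVec)
    rw [hW, finrank_euclideanSpace_fin] at this
    omega
  have horth : ∀ {L : QubitOp}, IsNormalToEllipse ρ L → blochVec L ∈ (V.map blochVec)ᗮ := by
    intro L hL
    rw [Submodule.mem_orthogonal']
    rintro _ ⟨v, hv, rfl⟩
    have h := hL.2.2.2 v hv
    rw [trace_mul_eq_inner_blochVec hL.2.1 hL.2.2.1 (hmem v hv).1 (hmem v hv).2] at h
    have h' := Complex.ofReal_eq_zero.mp h
    linarith
  have hz : IsRealOp (0 : QubitOp) := fun i j => by simp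
  have hne : (⟨blochVec H, horth hH⟩ : (V.map blochVec)ᗮ) ≠ 0 := by
    intro h
    refine hH.1 (eq_of_blochVec_eq hH.2.1 hH.2.2.1 Matrix.isHermitian_zero hz ?_)
    simpa using congrArg Subtype.val h
  obtain ⟨c, hc⟩ := (finrank_eq_one_iff_of_nonzero' _ hne).mp hWo ⟨blochVec K, horth hK⟩
  have hc' : c • blochVec H = blochVec K := congrArg Subtype.val hc
  have hcH : (c • H).IsHermitian := by
    ext i j
    have := hH.2.1.apply i j
    simp only [Matrix.conjTranspose_apply, Matrix.smul_apply, star_smul, this]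
    simp
  have hcr : IsRealOp (c • H) := fun i j => by simp [hH.2.2.1 i j]
  have hcK : c • H = K :=
    eq_of_blochVec_eq hcH hcr hK.2.1 hK.2.2.1 (by rw [map_smul, hc'])
  refine ⟨c, ?_, hcK⟩
  rintro rfl
  exact hK.1 (by rw [← hcK, zero_smul])

/-- If the steering ellipse is not degenerate, its tilt is that of any of its normal vectors. -/
theorem tilt_eq_ellipseTilt {ρ : TwoQubitOp} (hρ : IsRealDensity ρ)
    (hdim : Module.finrank ℝ (vectorSpan ℝ (Set.range (steeringEllipse ρ))) = 2)
    {H : QubitOp} (hH : IsNormalToEllipse ρ H) : tilt H = ellipseTilt ρ := by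
  rw [ellipseTilt, if_pos hdim]
  refine le_antisymm (le_iInf₂ fun K hK => ?_) (iInf₂_le H hH)
  obtain ⟨c, hc, rfl⟩ := exists_smul_eq_of_isNormalToEllipse hρ hdim hH hK
  rw [tilt_smul hc]

/-- A family `σ` of subnormalized one-qubit states has a local hidden state model if there are
a probability distribution `μ` on `RP1` and response functions `f a : RP1 → [0, 1]` such that
`σ a = ∫ x, f a x • x ∂μ` for all `a`. The integral of the (bounded, measurable) matrix-valued
function is taken entry by entry. -/
def HasLHSModel {ι : Type*} (σ : ι → QubitOp) : Prop :=
  ∃ (μ : Measure RP1) (f : ι → RP1 → ℝ), IsProbabilityMeasure μ ∧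
    ∀ a, Measurable (f a) ∧ (∀ x, f a x ∈ Set.Icc (0 : ℝ) 1) ∧
      σ a = Matrix.of fun i j => ∫ x : RP1, (f a x : ℂ) * (x : QubitOp) i j ∂μ

/-- The derivative of a curve of operators, entry by entry. -/
def curveDeriv (S : ℝ → QubitOp) (t : ℝ) : QubitOp :=
  Matrix.of fun i j => deriv (fun s => S s i j) t

/-- The length in trace norm of a curve of operators with parameter interval `[a, b]`. -/
def traceNormLength (S : ℝ → QubitOp) (a b : ℝ) : ℝ :=
  ∫ t in a..b, traceNorm (curveDeriv S t)

end

/-!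
Every velocity of the steering ellipse is orthogonal to a normal operator `H`. When the tilt of `H`
is at most one, this forces the trace norm of the velocity to be the Euclidean length of its Bloch
vector in the plane, so the trace-norm length is a Euclidean length. By Crofton's formula, it is a
quarter of the integral over all unit vectors `e` of the variation of the curve in the direction
`e`. For an ellipse, this variation over a period is twice the width in the direction `e`, and in a
local hidden state model with distribution `μ` the width is at most `∫ |⟪e, r(x)⟫| dμ(x)`, where
`r(x)` is the Bloch vector of the hidden state `x`. Integrating over `e` with the same formula
bounds the length by `2 ∫ ‖r(x)‖ dμ(x)`, which is `2` because hidden states are pure.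
-/

open scoped InnerProductSpace

section Ellipse

variable {E F : Type*} [AddCommGroup E] [Module ℝ E] [AddCommGroup F] [Module ℝ F]

/-- The parametrized ellipse `t ↦ a + cos t • b + sin t • c` with centre `a` and conjugate
half-diameters `b` and `c`. The half-diameters may be linearly dependent, and then the ellipse is a
segment or a point. Its velocity is again of this form, namely `ellipse 0 c (-b)`. -/
noncomputable def ellipse (a b c : E) (t : ℝ) : E :=
  a + Real.cos t • b + Real.sin t • c

theorem map_ellipse (L : E →ₗ[ℝ] F) (a b c : E) (t : ℝ) :
    L (ellipse a b c t) = ellipse (L a) (L b) (L c) t := by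
  simp only [ellipse, map_add, map_smul]

theorem ellipse_velocity_eq_smul_sub (a b c : E) (t : ℝ) :
    ellipse 0 c (-b) t
      = (1 / 2 : ℝ) • (ellipse a b c (t + Real.pi / 2) - ellipse a b c (t - Real.pi / 2)) := by
  simp only [ellipse, Real.cos_add_pi_div_two, Real.sin_add_pi_div_two, Real.cos_sub_pi_div_two,
    Real.sin_sub_pi_div_two]
  module

theorem ellipse_velocity_mem_vectorSpan (a b c : E) (t : ℝ) :
    ellipse 0 c (-b) t ∈ vectorSpan ℝ (Set.range (ellipse a b c)) := by
  rw [ellipse_velocity_eq_smul_sub a]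
  exact Submodule.smul_mem _ _ (vsub_mem_vectorSpan ℝ ⟨_, rfl⟩ ⟨_, rfl⟩)

theorem ellipse_velocity_mem {V : Submodule ℝ E} {a b c : E} (h : ∀ t, ellipse a b c t ∈ V)
    (t : ℝ) : ellipse 0 c (-b) t ∈ V := by
  rw [ellipse_velocity_eq_smul_sub a]
  exact V.smul_mem _ (V.sub_mem (h _) (h _))

end Ellipse

section NormedEllipse

variable {E : Type*} [NormedAddCommGroup E] [NormedSpace ℝ E]

theorem hasDerivAt_ellipse (a b c : E) (t : ℝ) :
    HasDerivAt (ellipse a b c) (ellipse 0 c (-b) t) t := by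
  convert (((Real.hasDerivAt_cos t).smul_const b).const_add a).add
    ((Real.hasDerivAt_sin t).smul_const c) using 1
  · rfl
  · simp only [ellipse]
    module

theorem continuous_ellipse (a b c : E) : Continuous (ellipse a b c) :=
  continuous_iff_continuousAt.mpr fun t => (hasDerivAt_ellipse a b c t).continuousAt

end NormedEllipse

section Crofton

theorem integral_abs_cos : ∫ t in (0 : ℝ)..2 * Real.pi, |Real.cos t| = 4 := by
  have hper : Function.Periodic (fun t => |Real.cos t|) Real.pi := fun t => by
    simp only [Real.cos_add_pi, abs_neg]
  have hint (a b : ℝ) : IntervalIntegrable (fun t => |Real.cos t|) volume a b :=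
    Real.continuous_cos.abs.intervalIntegrable a b
  have hhalf (a : ℝ) : ∫ t in a..a + Real.pi, |Real.cos t| = 2 := calc
    ∫ t in a..a + Real.pi, |Real.cos t|
      = ∫ t in -(Real.pi / 2)..Real.pi / 2, |Real.cos t| := by
        rw [hper.intervalIntegral_add_eq a (-(Real.pi / 2)), neg_add_eq_sub, sub_half]
    _ = ∫ t in -(Real.pi / 2)..Real.pi / 2, Real.cos t :=
        intervalIntegral.integral_congr fun t ht => abs_of_nonneg <|
          Real.cos_nonneg_of_mem_Icc <| by
            rwa [Set.uIcc_of_le (by linarith [Real.pi_pos])] at ht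
    _ = 2 := by
        rw [integral_cos, Real.sin_neg, Real.sin_pi_div_two]
        norm_num
  rw [← intervalIntegral.integral_add_adjacent_intervals (hint 0 (0 + Real.pi)) (hint _ _),
    two_mul, ← zero_add (Real.pi + Real.pi), ← add_assoc, hhalf, hhalf]
  norm_num

theorem inner_circleMap_eq_re_add_im (z : ℂ) (φ : ℝ) :
    ⟪circleMap 0 1 φ, z⟫_ℝ = z.re * Real.cos φ + z.im * Real.sin φ := by
  simp [Complex.inner, circleMap, Complex.exp_ofReal_mul_I_re, Complex.exp_ofReal_mul_I_im]

theorem inner_circleMap_eq_norm_mul_cos (z : ℂ) (φ : ℝ) :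
    ⟪circleMap 0 1 φ, z⟫_ℝ = ‖z‖ * Real.cos (φ - z.arg) := by
  rw [inner_circleMap_eq_re_add_im, Real.cos_sub]
  linear_combination (-Real.cos φ) * Complex.norm_mul_cos_arg z
    - Real.sin φ * Complex.norm_mul_sin_arg z

theorem integral_abs_inner_circleMap (z : ℂ) :
    ∫ φ in (0 : ℝ)..2 * Real.pi, |⟪circleMap 0 1 φ, z⟫_ℝ| = 4 * ‖z‖ := by
  have hper : Function.Periodic (fun t => |Real.cos t|) (2 * Real.pi) := fun t => by
    simp only [Real.cos_add_two_pi]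
  simp only [inner_circleMap_eq_norm_mul_cos, abs_mul, abs_norm,
    intervalIntegral.integral_const_mul]
  rw [intervalIntegral.integral_comp_sub_right (fun t => |Real.cos t|), zero_sub,
    sub_eq_neg_add, hper.intervalIntegral_add_eq _ 0, zero_add, integral_abs_cos, mul_comm]

variable {Ω : Type*} [MeasurableSpace Ω] {μ : Measure Ω} [SFinite μ] {v : Ω → ℂ}

theorem integrable_prod_abs_inner_circleMap (hv : Integrable v μ) :
    Integrable (Function.uncurry fun (φ : ℝ) (x : Ω) => |⟪circleMap 0 1 φ, v x⟫_ℝ|)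
      ((volume.restrict (Set.uIoc 0 (2 * Real.pi))).prod μ) := by
  have : IsFiniteMeasure (volume.restrict (Set.uIoc (0 : ℝ) (2 * Real.pi))) :=
    ⟨by simp [Set.uIoc]⟩
  refine (hv.norm.comp_snd _).mono ?_ (.of_forall fun p => ?_)
  · have hcircle : Measurable fun p : ℝ × Ω => circleMap 0 1 p.1 :=
      (continuous_circleMap 0 1).measurable.comp measurable_fst
    exact (hcircle.aestronglyMeasurable.inner hv.1.comp_snd (𝕜 := ℝ)).norm
  · simpa [Function.uncurry] using norm_inner_le_norm (𝕜 := ℝ) (circleMap 0 1 p.1) (v p.2)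

theorem intervalIntegrable_integral_abs_inner_circleMap (hv : Integrable v μ) :
    IntervalIntegrable (fun φ => ∫ x, |⟪circleMap 0 1 φ, v x⟫_ℝ| ∂μ) volume 0 (2 * Real.pi) :=
  intervalIntegrable_iff.mpr (integrable_prod_abs_inner_circleMap hv).integral_prod_left

/-- This is Crofton's formula when `v` is the velocity of a plane curve. -/
theorem integral_integral_abs_inner_circleMap (hv : Integrable v μ) :
    ∫ φ in (0 : ℝ)..2 * Real.pi, ∫ x, |⟪circleMap 0 1 φ, v x⟫_ℝ| ∂μ = 4 * ∫ x, ‖v x‖ ∂μ := by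
  rw [intervalIntegral_integral_swap (integrable_prod_abs_inner_circleMap hv)]
  simp only [integral_abs_inner_circleMap, integral_const_mul]

theorem ellipse_real_eq_add_inner (a b c t : ℝ) :
    ellipse a b c t = a + ⟪circleMap 0 1 t, ⟨b, c⟩⟫_ℝ := by
  rw [inner_circleMap_eq_re_add_im, ellipse, smul_eq_mul, smul_eq_mul, mul_comm b, mul_comm c,
    add_assoc]

-- The total variation over a period is twice the oscillation.
theorem integral_abs_ellipse_velocity_le {a b c M : ℝ}
    (h : ∀ s t, ellipse a b c s - ellipse a b c t ≤ M) :
    ∫ t in (0 : ℝ)..2 * Real.pi, |ellipse 0 c (-b) t| ≤ 2 * M := by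
  set z : ℂ := ⟨b, c⟩ with hz
  have hosc : 2 * ‖z‖ ≤ M := by
    have hmax : ellipse a b c z.arg = a + ‖z‖ := by
      rw [ellipse_real_eq_add_inner, inner_circleMap_eq_norm_mul_cos, sub_self,
        Real.cos_zero, mul_one]
    have hmin : ellipse a b c (z.arg + Real.pi) = a - ‖z‖ := by
      rw [ellipse_real_eq_add_inner, inner_circleMap_eq_norm_mul_cos, add_sub_cancel_left,
        Real.cos_pi]
      ring
    linarith [h z.arg (z.arg + Real.pi)]
  have hnorm : ‖(⟨c, -b⟩ : ℂ)‖ = ‖z‖ := by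
    simp only [hz, Complex.norm_def, Complex.normSq_mk, neg_mul_neg, add_comm]
  simp only [ellipse_real_eq_add_inner, zero_add, integral_abs_inner_circleMap, hnorm]
  linarith

theorem integral_norm_ellipse_velocity_le (hv : Integrable v μ) {a b c : ℂ}
    (h : ∀ φ s t, ⟪circleMap 0 1 φ, ellipse a b c s⟫_ℝ - ⟪circleMap 0 1 φ, ellipse a b c t⟫_ℝ
      ≤ ∫ x, |⟪circleMap 0 1 φ, v x⟫_ℝ| ∂μ) :
    ∫ t in (0 : ℝ)..2 * Real.pi, ‖ellipse 0 c (-b) t‖ ≤ 2 * ∫ x, ‖v x‖ ∂μ := by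
  have hvel : IntegrableOn (ellipse 0 c (-b)) (Set.Ioc 0 (2 * Real.pi)) :=
    ((continuous_ellipse 0 c (-b)).intervalIntegrable 0 _).1
  have hdir (φ : ℝ) : ∫ t in Set.Ioc 0 (2 * Real.pi), |⟪circleMap 0 1 φ, ellipse 0 c (-b) t⟫_ℝ|
      ≤ 2 * ∫ x, |⟪circleMap 0 1 φ, v x⟫_ℝ| ∂μ := by
    have hlin (p q r : ℂ) (t : ℝ) : ⟪circleMap 0 1 φ, ellipse p q r t⟫_ℝ
        = ellipse ⟪circleMap 0 1 φ, p⟫_ℝ ⟪circleMap 0 1 φ, q⟫_ℝ ⟪circleMap 0 1 φ, r⟫_ℝ t :=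
      map_ellipse (innerₗ ℂ (circleMap 0 1 φ)) p q r t
    rw [← intervalIntegral.integral_of_le Real.two_pi_pos.le]
    simpa only [hlin, inner_neg_right, inner_zero_right]
      using integral_abs_ellipse_velocity_le fun s t => by simpa only [hlin] using h φ s t
  have hcrofton : 4 * ∫ t in (0 : ℝ)..2 * Real.pi, ‖ellipse 0 c (-b) t‖
      ≤ 2 * (4 * ∫ x, ‖v x‖ ∂μ) := by
    rw [intervalIntegral.integral_of_le Real.two_pi_pos.le,
      ← integral_integral_abs_inner_circleMap hvel, ← integral_integral_abs_inner_circleMap hv,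
      ← intervalIntegral.integral_const_mul]
    exact intervalIntegral.integral_mono_on Real.two_pi_pos.le
      (intervalIntegrable_integral_abs_inner_circleMap hvel)
      ((intervalIntegrable_integral_abs_inner_circleMap hv).const_mul 2) fun φ _ => hdir φ
  linarith

end Crofton

section BlochPlane

/-- The real symmetric operators on one qubit, that is, the real Hermitian ones, as a subspace: it
contains the steering ellipse and hence its velocities. -/
def realSymmetricOps : Submodule ℝ QubitOp where
  carrier := {X | X.IsHermitian ∧ IsRealOp X}
  zero_mem' := ⟨Matrix.isHermitian_zero, fun _ _ => by simp⟩
  add_mem' hX hY := ⟨hX.1.add hY.1, fun _ _ => by simp [hX.2 _ _, hY.2 _ _]⟩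
  smul_mem' c X hX := ⟨hX.1.smul (IsSelfAdjoint.all c), fun _ _ => by simp [hX.2 _ _]⟩

/-- The point `(r₃, r₁)` of the plane of Bloch vectors, as a complex number. The projector
`|θ⟩⟨θ|` is sent to `exp (i θ)`. -/
def blochPlane : QubitOp →ₗ[ℝ] ℂ where
  toFun X := ⟨blochR3 X, blochR1 X⟩
  map_add' X Y := by
    apply Complex.ext <;> simp [blochR1, blochR3, add_mul]
  map_smul' c X := by
    apply Complex.ext <;> simp [blochR1, blochR3]

theorem norm_blochPlane (X : QubitOp) :
    ‖blochPlane X‖ = Real.sqrt (blochR1 X ^ 2 + blochR3 X ^ 2) := by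
  rw [Complex.norm_def, Complex.normSq_apply, add_comm, ← sq, ← sq]
  rfl

theorem inner_blochVec (X Y : QubitOp) :
    ⟪blochVec X, blochVec Y⟫_ℝ = blochN X * blochN Y + ⟪blochPlane X, blochPlane Y⟫_ℝ := by
  simp only [blochVec, blochPlane, PiLp.inner_apply, Fin.sum_univ_three, Complex.inner,
    LinearMap.coe_mk, AddHom.coe_mk, cons_val_zero, cons_val_one, cons_val,
    RCLike.inner_apply, Real.ringHom_apply, Complex.mul_re, Complex.conj_re, Complex.conj_im]
  ring

theorem trace_conjTranspose_mul_self {X : QubitOp} (hX : X ∈ realSymmetricOps) :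
    (Xᴴ * X).trace.re = (blochN X ^ 2 + ‖blochPlane X‖ ^ 2) / 2 := by
  rw [trace_mul_eq_inner_blochVec hX.1 hX.2 hX.1 hX.2, Complex.ofReal_re, inner_blochVec,
    real_inner_self_eq_norm_sq, sq (blochN X)]

theorem det_eq_blochN_sq_sub {X : QubitOp} (hX : X ∈ realSymmetricOps) :
    X.det = (((blochN X ^ 2 - ‖blochPlane X‖ ^ 2) / 4 : ℝ) : ℂ) := by
  rw [norm_blochPlane, Real.sq_sqrt (by positivity)]
  conv_lhs => rw [eq_bloch hX.1 hX.2]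
  generalize blochN X = n, blochR1 X = r₁, blochR3 X = r₃
  simp only [pauli1, pauli3, Matrix.det_fin_two, Matrix.add_apply, Matrix.smul_apply,
    Matrix.one_apply_eq, of_apply, cons_val', cons_val_zero, cons_val_one, cons_val_fin_one,
    ne_eq, zero_ne_one, one_ne_zero, not_false_eq_true, Matrix.one_apply_ne, smul_eq_mul]
  push_cast
  ring

theorem traceNorm_nonneg (X : QubitOp) : 0 ≤ traceNorm X :=
  (Complex.nonneg_iff.mp (Matrix.nonneg_iff_posSemidef.mp (CFC.abs_nonneg X)).trace_nonneg).1

theorem det_abs_eq_norm_det (X : QubitOp) : (CFC.abs X).det = (‖X.det‖ : ℂ) := by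
  have hnonneg : 0 ≤ (CFC.abs X).det :=
    (Matrix.nonneg_iff_posSemidef.mp (CFC.abs_nonneg X)).det_nonneg
  have hsq : ‖(CFC.abs X).det‖ ^ 2 = ‖X.det‖ ^ 2 := by
    rw [← norm_pow, sq, ← Matrix.det_mul, CFC.abs_mul_abs, Matrix.star_eq_conjTranspose,
      Matrix.det_mul, Matrix.det_conjTranspose, norm_mul, norm_star, sq]
  rw [← (sq_eq_sq₀ (norm_nonneg _) (norm_nonneg _)).mp hsq, Complex.eq_coe_norm_of_nonneg hnonneg,
    Complex.norm_real, norm_norm]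

theorem traceNorm_sq (X : QubitOp) :
    traceNorm X ^ 2 = (Xᴴ * X).trace.re + 2 * ‖X.det‖ := by
  have htrace : ((traceNorm X : ℝ) : ℂ) = (CFC.abs X).trace :=
    (Complex.eq_re_of_ofReal_le (r := 0) <| by
      exact_mod_cast (Matrix.nonneg_iff_posSemidef.mp (CFC.abs_nonneg X)).trace_nonneg).symm
  have hcayley : (CFC.abs X).trace ^ 2 = (CFC.abs X * CFC.abs X).trace + 2 * (CFC.abs X).det := by
    simp only [Matrix.trace_fin_two, Matrix.det_fin_two, Matrix.mul_apply, Fin.sum_univ_two]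
    ring
  rw [CFC.abs_mul_abs, det_abs_eq_norm_det, ← htrace, Matrix.star_eq_conjTranspose] at hcayley
  simpa [← Complex.ofReal_pow] using congrArg Complex.re hcayley

theorem traceNorm_eq_max {X : QubitOp} (hX : X ∈ realSymmetricOps) :
    traceNorm X = max |blochN X| ‖blochPlane X‖ := by
  have hmax {x y : ℝ} (hx : 0 ≤ x) (hy : 0 ≤ y) :
      (x ^ 2 + y ^ 2) / 2 + 2 * |(x ^ 2 - y ^ 2) / 4| = max x y ^ 2 := by
    rcases le_total x y with h | h
    · rw [max_eq_right h, abs_of_nonpos (by linarith [pow_le_pow_left₀ hx h 2])]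
      ring
    · rw [max_eq_left h, abs_of_nonneg (by linarith [pow_le_pow_left₀ hy h 2])]
      ring
  rw [← sq_eq_sq₀ (traceNorm_nonneg X) (by positivity), traceNorm_sq,
    trace_conjTranspose_mul_self hX, det_eq_blochN_sq_sub hX, Complex.norm_real, Real.norm_eq_abs,
    ← sq_abs (blochN X), hmax (abs_nonneg _) (norm_nonneg _)]

theorem tilt_le_one_iff {H : QubitOp} :
    tilt H ≤ 1 ↔ blochN H ≠ 0 ∧ ‖blochPlane H‖ ≤ |blochN H| := by
  rw [tilt, ← norm_blochPlane]
  split_ifs with h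
  · simp [h]
  · rw [ENNReal.ofReal_le_one, div_le_one (abs_pos.mpr h), and_iff_right h]

theorem abs_blochN_le_norm_blochPlane {H X : QubitOp} (hH : tilt H ≤ 1)
    (horth : ⟪blochVec H, blochVec X⟫_ℝ = 0) : |blochN X| ≤ ‖blochPlane X‖ := by
  obtain ⟨hn, hr⟩ := tilt_le_one_iff.mp hH
  rw [inner_blochVec] at horth
  refine le_of_mul_le_mul_left ?_ (abs_pos.mpr hn)
  calc |blochN H| * |blochN X|
      = |⟪blochPlane H, blochPlane X⟫_ℝ| := by
        rw [← abs_mul, eq_neg_of_add_eq_zero_left horth, abs_neg]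
    _ ≤ ‖blochPlane H‖ * ‖blochPlane X‖ := abs_real_inner_le_norm _ _
    _ ≤ |blochN H| * ‖blochPlane X‖ := by gcongr

theorem traceNorm_eq_norm_blochPlane {H X : QubitOp} (hH : H ∈ realSymmetricOps)
    (hX : X ∈ realSymmetricOps) (htilt : tilt H ≤ 1) (horth : (Hᴴ * X).trace = 0) :
    traceNorm X = ‖blochPlane X‖ := by
  rw [trace_mul_eq_inner_blochVec hH.1 hH.2 hX.1 hX.2, Complex.ofReal_eq_zero,
    div_eq_zero_iff, or_iff_left two_ne_zero] at horth
  rw [traceNorm_eq_max hX, max_eq_right (abs_blochN_le_norm_blochPlane htilt horth)]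

end BlochPlane

section SteeringEllipse

/-- The operator `Tr_A [(X ⊗ I) ρ]` that Alice's effect `X` induces on Bob's side. -/
def steeringMap (ρ : TwoQubitOp) : QubitOp →ₗ[ℝ] QubitOp where
  toFun X := partialTraceA ((X ⊗ₖ (1 : QubitOp)) * ρ)
  map_add' X Y := by
    ext i j
    simp only [partialTraceA, Matrix.add_kronecker, add_mul, Matrix.add_apply, Matrix.of_apply,
      Finset.sum_add_distrib]
  map_smul' c X := by
    ext i j
    simp only [partialTraceA, Matrix.smul_kronecker, Matrix.smul_mul, Matrix.smul_apply,
      Matrix.of_apply, Finset.smul_sum, RingHom.id_apply]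

theorem projTheta_eq_ellipse :
    projTheta = ellipse ((1 / 2 : ℝ) • 1) ((1 / 2 : ℝ) • pauli3) ((1 / 2 : ℝ) • pauli1) := by
  funext θ
  have hcos : Real.cos θ = Real.cos (θ / 2) ^ 2 - Real.sin (θ / 2) ^ 2 := by
    rw [← Real.cos_two_mul', mul_div_cancel₀ θ two_ne_zero]
  have hsin : Real.sin θ = 2 * Real.sin (θ / 2) * Real.cos (θ / 2) := by
    rw [← Real.sin_two_mul, mul_div_cancel₀ θ two_ne_zero]
  have hone : (Real.sin (θ / 2) : ℂ) ^ 2 + (Real.cos (θ / 2) : ℂ) ^ 2 = 1 := by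
    exact_mod_cast Real.sin_sq_add_cos_sq (θ / 2)
  rw [projTheta, ketTheta, ellipse, hcos, hsin]
  generalize Real.cos (θ / 2) = x, Real.sin (θ / 2) = y at hone ⊢
  ext i j
  fin_cases i <;> fin_cases j <;>
    simp only [pauli1, pauli3, Matrix.vecMulVec_apply, Pi.star_apply, RCLike.star_def,
      Complex.conj_ofReal, Matrix.add_apply, Matrix.smul_apply, of_apply, cons_val', cons_val_zero,
      cons_val_one, cons_val_fin_one, Fin.zero_eta, Fin.mk_one, Matrix.one_apply_eq, ne_eq,
      zero_ne_one, one_ne_zero, not_false_eq_true, Matrix.one_apply_ne, Complex.real_smul] <;>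
    push_cast
  · linear_combination hone / 2
  · ring
  · ring
  · linear_combination hone / 2

theorem steeringEllipse_eq_ellipse (ρ : TwoQubitOp) :
    steeringEllipse ρ = ellipse (steeringMap ρ ((1 / 2 : ℝ) • 1))
      (steeringMap ρ ((1 / 2 : ℝ) • pauli3)) (steeringMap ρ ((1 / 2 : ℝ) • pauli1)) := by
  funext θ
  rw [← map_ellipse, ← projTheta_eq_ellipse]
  rfl

theorem hasDerivAt_ellipse_apply (A B C : QubitOp) (i j : Fin 2) (t : ℝ) :
    HasDerivAt (fun s => ellipse A B C s i j) (ellipse 0 C (-B) t i j) t := by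
  have hentry (A B C : QubitOp) (s : ℝ) : ellipse A B C s i j
      = ellipse (A i j) (B i j) (C i j) s :=
    map_ellipse (Matrix.entryLinearMap ℝ ℂ i j) A B C s
  simp only [hentry]
  exact hasDerivAt_ellipse (A i j) (B i j) (C i j) t

theorem curveDeriv_ellipse (A B C : QubitOp) (t : ℝ) :
    curveDeriv (ellipse A B C) t = ellipse 0 C (-B) t := by
  ext i j
  exact (hasDerivAt_ellipse_apply A B C i j t).deriv

theorem exists_isNormalToEllipse_tilt_lt {ρ : TwoQubitOp} {τ : ℝ≥0∞} (h : ellipseTilt ρ < τ) :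
    ∃ H, IsNormalToEllipse ρ H ∧ tilt H < τ := by
  rw [ellipseTilt] at h
  split_ifs at h
  · simpa only [iInf_lt_iff, exists_prop] using h
  · exact absurd h not_top_lt

theorem traceNorm_curveDeriv_steeringEllipse {ρ : TwoQubitOp} {H : QubitOp}
    (hreal : ∀ θ, steeringEllipse ρ θ ∈ realSymmetricOps) (hH : IsNormalToEllipse ρ H)
    (htilt : tilt H ≤ 1) (θ : ℝ) :
    traceNorm (curveDeriv (steeringEllipse ρ) θ)
      = ‖blochPlane (curveDeriv (steeringEllipse ρ) θ)‖ := by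
  obtain ⟨-, hHherm, hHreal, horth⟩ := hH
  rw [steeringEllipse_eq_ellipse] at hreal horth ⊢
  rw [curveDeriv_ellipse]
  exact traceNorm_eq_norm_blochPlane ⟨hHherm, hHreal⟩ (ellipse_velocity_mem hreal θ) htilt
    (horth _ (ellipse_velocity_mem_vectorSpan _ _ _ θ))

end SteeringEllipse

section HiddenStates

theorem map_matrix_integral {Ω m n V W : Type*} [MeasurableSpace Ω] {μ : Measure Ω} [Finite m]
    [Finite n] [NormedAddCommGroup V] [NormedSpace ℝ V] [FiniteDimensional ℝ V]
    [NormedAddCommGroup W] [NormedSpace ℝ W] [CompleteSpace W] (L : Matrix m n V →ₗ[ℝ] W)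
    {M : Ω → Matrix m n V} (hM : ∀ i j, Integrable (fun x => M x i j) μ) :
    L (Matrix.of fun i j => ∫ x, M x i j ∂μ) = ∫ x, L (M x) ∂μ := by
  cases nonempty_fintype m
  cases nonempty_fintype n
  have : CompleteSpace V := FiniteDimensional.complete ℝ V
  let L' : (m → n → V) →L[ℝ] W :=
    LinearMap.toContinuousLinearMap (L ∘ₗ (Matrix.ofLinearEquiv ℝ).toLinearMap)
  have hrow (i : m) : Integrable (fun x => M x i) μ := Integrable.of_eval (hM i)
  have hentry : (fun i j => ∫ x, M x i j ∂μ) = ∫ x, (fun i j => M x i j) ∂μ := by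
    ext i j
    rw [eval_integral hrow, eval_integral (hM i)]
  exact (congrArg L' hentry).trans (L'.integral_comp_comm (Integrable.of_eval hrow)).symm

theorem integrable_smul_of_mem_Icc {Ω E : Type*} [MeasurableSpace Ω] {μ : Measure Ω}
    [NormedAddCommGroup E] [NormedSpace ℝ E] {u : Ω → E} (hu : Integrable u μ) {f : Ω → ℝ}
    (hf : AEStronglyMeasurable f μ) (hf01 : ∀ x, f x ∈ Set.Icc (0 : ℝ) 1) :
    Integrable (fun x => f x • u x) μ :=
  hu.bdd_smul 1 hf (.of_forall fun x => (Real.norm_of_nonneg (hf01 x).1).trans_le (hf01 x).2)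

theorem map_integral_smul_sub_le {Ω E : Type*} [MeasurableSpace Ω] {μ : Measure Ω}
    [NormedAddCommGroup E] [NormedSpace ℝ E] [CompleteSpace E] (ℓ : E →L[ℝ] ℝ) {u : Ω → E}
    (hu : Integrable u μ) {f g : Ω → ℝ} (hf : AEStronglyMeasurable f μ)
    (hf01 : ∀ x, f x ∈ Set.Icc (0 : ℝ) 1) (hg : AEStronglyMeasurable g μ)
    (hg01 : ∀ x, g x ∈ Set.Icc (0 : ℝ) 1) :
    ℓ (∫ x, f x • u x ∂μ) - ℓ (∫ x, g x • u x ∂μ) ≤ ∫ x, |ℓ (u x)| ∂μ := by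
  have hfu := integrable_smul_of_mem_Icc hu hf hf01
  have hgu := integrable_smul_of_mem_Icc hu hg hg01
  have hsub : Integrable (fun x => f x • u x - g x • u x) μ := hfu.sub hgu
  rw [← map_sub, ← integral_sub hfu hgu, ← ℓ.integral_comp_comm hsub]
  refine integral_mono (ℓ.integrable_comp hsub) (ℓ.integrable_comp hu).abs fun x => ?_
  calc ℓ (f x • u x - g x • u x) = (f x - g x) * ℓ (u x) := by
        rw [← sub_smul, map_smul, smul_eq_mul]
    _ ≤ |f x - g x| * |ℓ (u x)| := (le_abs_self _).trans_eq (abs_mul _ _)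
    _ ≤ |ℓ (u x)| := mul_le_of_le_one_left (abs_nonneg _) <| by
        simpa using abs_sub_le_of_le_of_le (hf01 x).1 (hf01 x).2 (hg01 x).1 (hg01 x).2

theorem norm_apply_le_one_of_mem_RP1 (x : RP1) (i j : Fin 2) : ‖(x : QubitOp) i j‖ ≤ 1 := by
  obtain ⟨P, hherm, hidem, htrace, -⟩ := x
  have hsum : ∑ k, ∑ l, ‖P k l‖ ^ 2 = 1 := by
    have h : ∑ k, ∑ l, ((‖P k l‖ ^ 2 : ℝ) : ℂ) = (P * P).trace := by
      simp only [Matrix.trace, Matrix.diag, Matrix.mul_apply]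
      refine Finset.sum_congr rfl fun k _ => Finset.sum_congr rfl fun l _ => ?_
      rw [← hherm.apply l k, Complex.star_def, Complex.mul_conj']
      norm_cast
    rw [hidem, htrace] at h
    exact_mod_cast h
  refine (sq_le_one_iff₀ (norm_nonneg _)).mp ?_
  calc ‖P i j‖ ^ 2 ≤ ∑ l, ‖P i l‖ ^ 2 :=
        Finset.single_le_sum (fun l _ => sq_nonneg ‖P i l‖) (Finset.mem_univ j)
    _ ≤ ∑ k, ∑ l, ‖P k l‖ ^ 2 := Finset.single_le_sum (f := fun k => ∑ l, ‖P k l‖ ^ 2)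
        (fun k _ => by positivity) (Finset.mem_univ i)
    _ = 1 := hsum

theorem norm_blochPlane_of_mem_RP1 (x : RP1) : ‖blochPlane x‖ = 1 := by
  obtain ⟨P, hherm, hidem, htrace, hreal⟩ := x
  have h := trace_conjTranspose_mul_self (X := P) ⟨hherm, hreal⟩
  rw [hherm.eq, hidem, blochN, htrace, Complex.one_re] at h
  exact (pow_eq_one_iff_of_nonneg (norm_nonneg _) two_ne_zero).mp (by linarith)

/-- The subnormalized state `∫ f x • x ∂μ` that the response function `f` selects from the hidden
state distribution `μ`, with the integral taken entry by entry. -/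
noncomputable def lhsState (μ : Measure RP1) (f : RP1 → ℝ) : QubitOp :=
  Matrix.of fun i j => ∫ x : RP1, (f x : ℂ) * (x : QubitOp) i j ∂μ

theorem lhsState_mem_realSymmetricOps (μ : Measure RP1) (f : RP1 → ℝ) :
    lhsState μ f ∈ realSymmetricOps := by
  have hconj (i j : Fin 2) : star (lhsState μ f i j)
      = ∫ x : RP1, (f x : ℂ) * star ((x : QubitOp) i j) ∂μ := by
    simp only [lhsState, Matrix.of_apply, Complex.star_def, ← integral_conj, map_mul,
      Complex.conj_ofReal]
  refine ⟨?_, fun i j => ?_⟩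
  · ext i j
    rw [Matrix.conjTranspose_apply, hconj]
    exact integral_congr_ae (.of_forall fun x => by simp only [x.2.1.apply i j])
  · rw [← Complex.conj_eq_iff_im, ← Complex.star_def, hconj]
    refine integral_congr_ae (.of_forall fun x => ?_)
    simp only [Complex.star_def, Complex.conj_eq_iff_im.mpr (x.2.2.2.2 i j)]

variable {μ : Measure RP1} [IsFiniteMeasure μ]

theorem integrable_blochPlane_coe : Integrable (fun x : RP1 => blochPlane x) μ := by
  have hcont : Continuous fun x : RP1 => blochPlane x :=
    blochPlane.continuous_of_finiteDimensional.comp continuous_subtype_val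
  exact .of_bound hcont.aestronglyMeasurable 1
    (.of_forall fun x => (norm_blochPlane_of_mem_RP1 x).le)

theorem integrable_coe_apply (i j : Fin 2) : Integrable (fun x : RP1 => (x : QubitOp) i j) μ :=
  .of_bound (continuous_subtype_val.matrix_elem i j).aestronglyMeasurable 1
    (.of_forall fun x => norm_apply_le_one_of_mem_RP1 x i j)

theorem map_lhsState {W : Type*} [NormedAddCommGroup W] [NormedSpace ℝ W] [CompleteSpace W]
    (L : QubitOp →ₗ[ℝ] W) {f : RP1 → ℝ} (hf : Measurable f)
    (hf01 : ∀ x, f x ∈ Set.Icc (0 : ℝ) 1) : L (lhsState μ f) = ∫ x : RP1, f x • L x ∂μ := by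
  have hint (i j : Fin 2) : Integrable (fun x : RP1 => (f x • (x : QubitOp)) i j) μ :=
    integrable_smul_of_mem_Icc (integrable_coe_apply i j) hf.aestronglyMeasurable hf01
  simpa only [lhsState, map_smul, Matrix.smul_apply, Complex.real_smul]
    using map_matrix_integral L hint

theorem inner_blochPlane_lhsState_sub_le {f g : RP1 → ℝ} (hf : Measurable f)
    (hf01 : ∀ x, f x ∈ Set.Icc (0 : ℝ) 1) (hg : Measurable g)
    (hg01 : ∀ x, g x ∈ Set.Icc (0 : ℝ) 1) (e : ℂ) :
    ⟪e, blochPlane (lhsState μ f)⟫_ℝ - ⟪e, blochPlane (lhsState μ g)⟫_ℝ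
      ≤ ∫ x : RP1, |⟪e, blochPlane x⟫_ℝ| ∂μ := by
  rw [map_lhsState blochPlane hf hf01, map_lhsState blochPlane hg hg01]
  exact map_integral_smul_sub_le (innerSL ℝ e) integrable_blochPlane_coe
    hf.aestronglyMeasurable hf01 hg.aestronglyMeasurable hg01

end HiddenStates

theorem proposition2_general (ρ : TwoQubitOp) {H : QubitOp} (hH : IsNormalToEllipse ρ H)
    (htilt : tilt H ≤ 1) (hlhs : HasLHSModel (steeringEllipse ρ)) :
    (∀ i j, Differentiable ℝ (fun θ : ℝ => steeringEllipse ρ θ i j)) ∧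
      IntervalIntegrable (fun θ : ℝ => traceNorm (curveDeriv (steeringEllipse ρ) θ))
        volume 0 (2 * Real.pi) ∧
      traceNormLength (steeringEllipse ρ) 0 (2 * Real.pi) ≤ 2 := by
  obtain ⟨μ, f, hμ, hf⟩ := hlhs
  have hreal (θ : ℝ) : steeringEllipse ρ θ ∈ realSymmetricOps :=
    (hf θ).2.2 ▸ lhsState_mem_realSymmetricOps μ (f θ)
  obtain ⟨A, B, C, hell⟩ : ∃ A B C, steeringEllipse ρ = ellipse A B C :=
    ⟨_, _, _, steeringEllipse_eq_ellipse ρ⟩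
  have hspeed (θ : ℝ) : traceNorm (curveDeriv (steeringEllipse ρ) θ)
      = ‖ellipse 0 (blochPlane C) (-blochPlane B) θ‖ := by
    rw [traceNorm_curveDeriv_steeringEllipse hreal hH htilt, hell, curveDeriv_ellipse, map_ellipse,
      map_neg, map_zero]
  simp only [traceNormLength, hspeed]
  refine ⟨fun i j θ => hell ▸ (hasDerivAt_ellipse_apply A B C i j θ).differentiableAt,
    (continuous_ellipse _ _ _).norm.intervalIntegrable _ _, ?_⟩
  calc ∫ θ in (0 : ℝ)..2 * Real.pi, ‖ellipse 0 (blochPlane C) (-blochPlane B) θ‖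
      ≤ 2 * ∫ x : RP1, ‖blochPlane x‖ ∂μ :=
        integral_norm_ellipse_velocity_le integrable_blochPlane_coe fun φ s t => by
          rw [← map_ellipse blochPlane A, ← map_ellipse blochPlane A, ← hell, (hf s).2.2,
            (hf t).2.2]
          exact inner_blochPlane_lhsState_sub_le (hf s).1 (hf s).2.1 (hf t).1 (hf t).2.1 _
    _ = 2 := by
        simp only [norm_blochPlane_of_mem_RP1, integral_const, probReal_univ, one_smul, mul_one]

theorem proposition2 (ρ : TwoQubitOp) (hρ : IsRealDensity ρ)
    (htilt : ellipseTilt ρ < 1)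
    (hlhs : HasLHSModel (fun θ : ℝ => steeringEllipse ρ θ)) :
    (∀ i j, Differentiable ℝ (fun θ : ℝ => steeringEllipse ρ θ i j)) ∧
      IntervalIntegrable (fun θ : ℝ => traceNorm (curveDeriv (steeringEllipse ρ) θ))
        volume 0 (2 * Real.pi) ∧
      traceNormLength (steeringEllipse ρ) 0 (2 * Real.pi) ≤ 2 := by
  obtain ⟨H, hH, hlt⟩ := exists_isNormalToEllipse_tilt_lt htilt
  exact proposition2_general ρ hH hlt.le hlhs
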